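/- Let $d, J \ge 1$. Let $l : \mathbf R^d \to \mathbf R$ be an analytic, Lebesgue-integrable function whose inverse Fourier transform $f(x) = \int_{\mathbf R^d} e^{-i w^\top x}\, l(w)\, dw$ is (real and) strictly positive at every $x \in \mathbf R^d$. For a probability measure $P$ on $\mathbf R^d$ with characteristic function $\varphi_P$, let $\phi_P(t) = \int_{\mathbf R^d} \varphi_P(w)\, l(t-w)\, dw$ be its smooth characteristic function. Let $P, Q$ be probability measures on $\mathbf R^d$ with Lebesgue-integrable characteristic functions. Let $T_1,\dots,T_J$ be i.i.d. random vectors in $\mathbf R^d$, defined on a probability space $(\Omega_1, \mathbb P_1)$, whose law is absolutely continuous with respect to Lebesgue measure, and put $$d^2_{\phi,J}(P,Q) = \frac1J \sum_{j=1}^J |\phi_P(T_j) - \phi_Q(T_j)|^2 .$$ Let $X_1, X_2, \dots$ be i.i.d. from $P$ and $Y_1, Y_2, \dots$ i.i.d. from $Q$, the two samples being independent of each other and defined on a probability space $(\Omega_2, \mathbb P_2)$, so that on the product of the two spaces they are independent of the $T_j$. Let $Z_i \in \mathbf R^{2J}$ be the vector with entries $$f(X_i)\sin(X_i^\top T_j)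 - f(Y_i)\sin(Y_i^\top T_j), \qquad f(X_i)\cos(X_i^\top T_j) - f(Y_i)\cos(Y_i^\top T_j), \qquad j = 1,\dots,J,$$ and put $W_n = \frac1n\sum_{i=1}^n Z_i$, $\Sigma_n = \frac1n \sum_{i=1}^n Z_i Z_i^\top$, and $S_n = n\, W_n^\top \Sigma_n^{-1} W_n$ (with the convention $S_n = 0$ where $\Sigma_n$ is singular). Then for $\mathbb P_1$-almost every realization of $(T_1,\dots,T_J)$, held fixed, the following hold. 1. If $d^2_{\phi,J}(P,Q) = 0$ at this realization (in particular, if $P = Q$), then under $\mathbb P_2$ the statistic $S_n$ converges in distribution, as $n \to \infty$, to the $\chi^2$ distribution with $2J$ degrees of freedom. 2. If $d^2_{\phi,J}(P,Q) > 0$ at this realization, then $\mathbb P_2(S_n > r) \to 1$ as $n \to \infty$ for every fixed $r \in \mathbf R$. -/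

import Mathlib

open MeasureTheory ProbabilityTheory Filter Topology
open scoped Matrix

noncomputable section

/-- The smooth characteristic function of `P`: its characteristic function convolved with the
kernel `l`, `φ_P(t) = ∫ φ_P(w) l(t - w) dw`. -/
def smoothCharFun {d : ℕ} (l : EuclideanSpace ℝ (Fin d) → ℝ)
    (P : Measure (EuclideanSpace ℝ (Fin d))) (t : EuclideanSpace ℝ (Fin d)) : ℂ :=
  ∫ w, charFun P w * (l (t - w) : ℂ)

/-- The inverse Fourier transform `f(x) = ∫ exp(-i⟨w, x⟩) l(w) dw` of the kernel, normalised so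
that `∫ φ_P(w) l(t - w) dw = ∫ exp(i⟨t, x⟩) f(x) dP(x)`. -/
def invFourierKernel {d : ℕ} (l : EuclideanSpace ℝ (Fin d) → ℝ)
    (x : EuclideanSpace ℝ (Fin d)) : ℂ :=
  ∫ w, Complex.exp (-Complex.I * (inner ℝ w x : ℂ)) * (l w : ℂ)

/-- The squared distance `(1/J) ∑ⱼ |φ_P(tⱼ) - φ_Q(tⱼ)|²` between smooth characteristic functions
at the test points `t`. -/
def smoothCFDistSq {d J : ℕ} (l : EuclideanSpace ℝ (Fin d) → ℝ)
    (P Q : Measure (EuclideanSpace ℝ (Fin d))) (t : Fin J → EuclideanSpace ℝ (Fin d)) : ℝ :=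
  (1 / (J : ℝ)) * ∑ j, ‖smoothCharFun l P (t j) - smoothCharFun l Q (t j)‖ ^ 2

/-- The imaginary (second index `0`) and real (second index `1`) parts of
`exp(i⟨tⱼ, x⟩) f(x)`, stacked into a vector of length `2J`. -/
def smoothCFFeature {d J : ℕ} (l : EuclideanSpace ℝ (Fin d) → ℝ)
    (t : Fin J → EuclideanSpace ℝ (Fin d)) (x : EuclideanSpace ℝ (Fin d)) :
    Fin J × Fin 2 → ℝ :=
  fun p => (invFourierKernel l x).re *
    (if p.2 = 0 then Real.sin (inner ℝ x (t p.1)) else Real.cos (inner ℝ x (t p.1)))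

/-- The difference vector `Z` of a pair of observations `(x, y)`. -/
def smoothCFDiff {d J : ℕ} (l : EuclideanSpace ℝ (Fin d) → ℝ)
    (t : Fin J → EuclideanSpace ℝ (Fin d)) (x y : EuclideanSpace ℝ (Fin d)) :
    Fin J × Fin 2 → ℝ :=
  smoothCFFeature l t x - smoothCFFeature l t y

/-- `W_n = (1/n) ∑_{i < n} Z_i`. -/
def smoothCFMean {d J : ℕ} (l : EuclideanSpace ℝ (Fin d) → ℝ)
    (t : Fin J → EuclideanSpace ℝ (Fin d)) (x y : ℕ → EuclideanSpace ℝ (Fin d)) (n : ℕ) :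
    Fin J × Fin 2 → ℝ :=
  (1 / (n : ℝ)) • ∑ i ∈ Finset.range n, smoothCFDiff l t (x i) (y i)

/-- `Σ_n = (1/n) ∑_{i < n} Z_i Z_iᵀ`. -/
def smoothCFCov {d J : ℕ} (l : EuclideanSpace ℝ (Fin d) → ℝ)
    (t : Fin J → EuclideanSpace ℝ (Fin d)) (x y : ℕ → EuclideanSpace ℝ (Fin d)) (n : ℕ) :
    Matrix (Fin J × Fin 2) (Fin J × Fin 2) ℝ :=
  (1 / (n : ℝ)) • ∑ i ∈ Finset.range n,
    Matrix.vecMulVec (smoothCFDiff l t (x i) (y i)) (smoothCFDiff l t (x i) (y i))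

/-- The statistic `S_n = n W_nᵀ Σ_n⁻¹ W_n`. (The inverse of a singular matrix is `0`.) -/
def smoothCFStat {d J : ℕ} (l : EuclideanSpace ℝ (Fin d) → ℝ)
    (t : Fin J → EuclideanSpace ℝ (Fin d)) (x y : ℕ → EuclideanSpace ℝ (Fin d)) (n : ℕ) : ℝ :=
  (n : ℝ) * (smoothCFMean l t x y n ⬝ᵥ ((smoothCFCov l t x y n)⁻¹ *ᵥ smoothCFMean l t x y n))

/-- The `χ²` distribution with `k` degrees of freedom: the law of the sum of squares of `k`
independent standard normal variables. -/
def chiSquared (k : ℕ) : Measure ℝ :=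
  (Measure.pi (fun _ : Fin k => gaussianReal 0 1)).map (fun z => ∑ i, z i ^ 2)

instance chiSquared.instIsProbabilityMeasure (k : ℕ) : IsProbabilityMeasure (chiSquared k) :=
  Measure.isProbabilityMeasure_map
    (by fun_prop : Measurable (fun z : Fin k → ℝ => ∑ i, z i ^ 2)).aemeasurable

end

/-! By Fubini, `smoothCharFun l P t` is the integral of `exp(i⟨x, t⟩) f(x)` against `P`. Since `f`
is real, the squared distance vanishes exactly when the `Z_i` have mean zero
(`smoothCFDistSq_eq_zero_iff`). The `Z_i` are i.i.d. and bounded. Once their second-moment matrix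
`Σ` is positive definite, the central limit theorem and Slutsky give the `χ²` limit under zero mean;
otherwise the strong law gives `S_n / n → mᵀ Σ⁻¹ m > 0`, with `m` the mean.

The real issue is that `Σ` is nonsingular for almost every choice of test points. If `aᵀ Z = 0`
almost surely, freezing `y` shows that `f` times a trigonometric polynomial is `P`-a.s. constant. A
trigonometric polynomial vanishing `P`-a.s. is trivial (`eq_zero_of_ae_sum_cexp_inner_eq_zero`), so
that constant is nonzero and `1/f` is `P`-a.s. a trigonometric polynomial in the test frequencies.
Two bad configurations with no common frequency up to sign would give two such expressions for
`1/f`, which is impossible (`SeparatedFrequencies.trigNondegenerate_or`). Hence all bad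
configurations with separated frequencies meet the frequencies, up to sign, of any single one, and
atomless test points almost surely avoid these (`ae_trigNondegenerate`). -/

/-! ### Matrix square roots and inverses -/

section QuadraticForms

variable {ι : Type*} [Fintype ι] [DecidableEq ι]

open scoped MatrixOrder in
theorem Matrix.PosDef.sqrt_dotProduct_inv_mulVec_sqrt {S : Matrix ι ι ℝ} (hS : S.PosDef)
    (z : ι → ℝ) :
    (CFC.sqrt S *ᵥ z) ⬝ᵥ (S⁻¹ *ᵥ (CFC.sqrt S *ᵥ z)) = z ⬝ᵥ z := by
  have hnonneg : (0 : Matrix ι ι ℝ) ≤ S := Matrix.nonneg_iff_posSemidef.mpr hS.posSemidef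
  have hsq : CFC.sqrt S * CFC.sqrt S = S := CFC.sqrt_mul_sqrt_self S hnonneg
  have hherm : (CFC.sqrt S)ᵀ = CFC.sqrt S := by
    have h := (Matrix.nonneg_iff_posSemidef.mp (CFC.sqrt_nonneg S)).isHermitian
    simpa [Matrix.IsHermitian, Matrix.conjTranspose_eq_transpose_of_trivial] using h
  have hdet : IsUnit (CFC.sqrt S).det := by
    have h : (CFC.sqrt S).det * (CFC.sqrt S).det = S.det := by rw [← Matrix.det_mul, hsq]
    refine isUnit_iff_ne_zero.mpr fun h0 => hS.det_pos.ne' ?_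
    rw [← h, h0, zero_mul]
  have hinv : CFC.sqrt S * (S⁻¹ * CFC.sqrt S) = 1 := by
    conv_lhs => enter [2, 1]; rw [← hsq, Matrix.mul_inv_rev]
    rw [Matrix.mul_assoc, Matrix.nonsing_inv_mul _ hdet, Matrix.mul_one,
      Matrix.mul_nonsing_inv _ hdet]
  rw [Matrix.mulVec_mulVec, Matrix.dotProduct_mulVec, ← Matrix.mulVec_transpose,
    Matrix.transpose_mul, hherm, Matrix.mulVec_mulVec]
  have h2 : (S⁻¹ * CFC.sqrt S)ᵀ * CFC.sqrt S = 1 := by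
    have := congrArg Matrix.transpose hinv
    rwa [Matrix.transpose_mul, hherm, Matrix.transpose_one] at this
  rw [Matrix.transpose_mul, hherm] at h2
  rw [h2, Matrix.one_mulVec]

theorem Matrix.tendsto_inv_of_det_ne_zero {α : Type*} {F : Filter α} {A : α → Matrix ι ι ℝ}
    {S : Matrix ι ι ℝ} (h : Tendsto A F (𝓝 S)) (hS : S.det ≠ 0) :
    Tendsto (fun a => (A a)⁻¹) F (𝓝 S⁻¹) := by
  simp only [Matrix.inv_def, Ring.inverse_eq_inv']
  exact (((continuous_id.matrix_det.tendsto S).comp h).inv₀ hS).smul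
    ((continuous_id.matrix_adjugate.tendsto S).comp h)

/-- The formula `det⁻¹ • adjugate` also covers singular matrices, as `0⁻¹ = 0`, so inversion is
measurable everywhere although it is continuous only where the determinant is nonzero. -/
theorem Matrix.aemeasurable_inv {α : Type*} [MeasurableSpace α] {A : α → Matrix ι ι ℝ}
    {μ : Measure α} (h : ∀ p q, AEMeasurable (fun a => A a p q) μ) :
    AEMeasurable (fun a => (fun p q => (A a)⁻¹ p q : ι → ι → ℝ)) μ := by
  have hA : AEMeasurable (fun a => (fun p q => A a p q : ι → ι → ℝ)) μ :=
    aemeasurable_pi_lambda _ fun p => aemeasurable_pi_lambda _ fun q => h p q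
  have hdet : Measurable fun M : ι → ι → ℝ => (Matrix.of M).det :=
    have h : Continuous fun M : ι → ι → ℝ => (Matrix.of M).det :=
      Continuous.matrix_det (A := fun M : ι → ι → ℝ => Matrix.of M) continuous_id
    h.measurable
  have hadj (p q) : Measurable fun M : ι → ι → ℝ => (Matrix.of M).adjugate p q :=
    have h : Continuous fun M : ι → ι → ℝ => (Matrix.of M).adjugate p q :=
      (Continuous.matrix_adjugate (A := fun M : ι → ι → ℝ => Matrix.of M)
        continuous_id).matrix_elem p q
    h.measurable
  have hinv : Measurable fun M : ι → ι → ℝ => (fun p q => (Matrix.of M)⁻¹ p q : ι → ι → ℝ) := by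
    refine measurable_pi_lambda _ fun p => measurable_pi_lambda _ fun q => ?_
    simp only [Matrix.inv_def, Ring.inverse_eq_inv', Matrix.smul_apply, smul_eq_mul]
    exact hdet.inv.mul (hadj p q)
  exact hinv.comp_aemeasurable hA

end QuadraticForms

/-! ### Asymptotics of the studentized statistic for i.i.d. vectors -/

noncomputable section StudentizedStatistic

variable {ι : Type*} [Fintype ι] [DecidableEq ι]

/-- Hotelling-type statistic `n Wₙᵀ Σₙ⁻¹ Wₙ` of a sequence of vectors, with uncentred `Σₙ`. -/
def studentizedStat (z : ℕ → ι → ℝ) (n : ℕ) : ℝ :=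
  (n : ℝ) * (((1 / (n : ℝ)) • ∑ i ∈ Finset.range n, z i) ⬝ᵥ
    (((1 / (n : ℝ)) • ∑ i ∈ Finset.range n, Matrix.vecMulVec (z i) (z i))⁻¹ *ᵥ
      ((1 / (n : ℝ)) • ∑ i ∈ Finset.range n, z i)))

/-- Splitting the factor `n` as `√n · √n` puts both vectors on the scale of the central limit
theorem. -/
theorem studentizedStat_eq (z : ℕ → ι → ℝ) (n : ℕ) :
    studentizedStat z n = ((√(n : ℝ))⁻¹ • ∑ i ∈ Finset.range n, z i) ⬝ᵥ
      (((1 / (n : ℝ)) • ∑ i ∈ Finset.range n, Matrix.vecMulVec (z i) (z i))⁻¹ *ᵥ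
      ((√(n : ℝ))⁻¹ • ∑ i ∈ Finset.range n, z i)) := by
  rcases Nat.eq_zero_or_pos n with rfl | hn
  · simp [studentizedStat]
  have hn' : (0 : ℝ) < n := by exact_mod_cast hn
  have hs : (√(n : ℝ))⁻¹ * (√(n : ℝ))⁻¹ = (n : ℝ)⁻¹ := by
    rw [← mul_inv, Real.mul_self_sqrt hn'.le]
  rw [studentizedStat]
  simp only [Matrix.mulVec_smul, smul_dotProduct, dotProduct_smul, smul_eq_mul]
  rw [← mul_assoc (√(n : ℝ))⁻¹, hs]
  field_simp

variable {Ω : Type*} [MeasurableSpace Ω] {μ : Measure Ω}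
  {Z : ℕ → Ω → ι → ℝ}

omit [DecidableEq ι] in
theorem ae_tendsto_sampleMean [IsProbabilityMeasure μ] (hident : ∀ i, IdentDistrib (Z i) (Z 0) μ μ)
    (hindep : iIndepFun Z μ) (hint : ∀ p, MemLp (fun ω => Z 0 ω p) 2 μ) :
    ∀ᵐ ω ∂μ, Tendsto (fun n : ℕ => (1 / (n : ℝ)) • ∑ i ∈ Finset.range n, Z i ω) atTop
      (𝓝 fun p => ∫ ω, Z 0 ω p ∂μ) := by
  have h (p : ι) := strong_law_ae_real (fun i ω => Z i ω p) ((hint p).integrable one_le_two)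
    (fun i j hij => (hindep.indepFun hij).comp (measurable_pi_apply p) (measurable_pi_apply p))
    (fun i => (hident i).comp (measurable_pi_apply p))
  filter_upwards [ae_all_iff.mpr h] with ω hω
  refine tendsto_pi_nhds.mpr fun p => ?_
  simpa [div_eq_inv_mul] using hω p

omit [DecidableEq ι] in
theorem ae_tendsto_sampleSecondMoment (hident : ∀ i, IdentDistrib (Z i) (Z 0) μ μ)
    (hindep : iIndepFun Z μ) (hint : ∀ p, MemLp (fun ω => Z 0 ω p) 2 μ) :
    ∀ᵐ ω ∂μ, Tendsto
      (fun n : ℕ => (1 / (n : ℝ)) • ∑ i ∈ Finset.range n, Matrix.vecMulVec (Z i ω) (Z i ω)) atTop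
      (𝓝 (Matrix.of fun p q => ∫ ω, Z 0 ω p * Z 0 ω q ∂μ)) := by
  have hm (p q : ι) : Measurable fun v : ι → ℝ => v p * v q := by fun_prop
  have h (p q : ι) := strong_law_ae_real (fun i ω => Z i ω p * Z i ω q)
    ((hint p).integrable_mul (hint q))
    (fun i j hij => (hindep.indepFun hij).comp (hm p q) (hm p q))
    (fun i => (hident i).comp (hm p q))
  filter_upwards [ae_all_iff.mpr fun p => ae_all_iff.mpr (h p)] with ω hω
  refine tendsto_pi_nhds.mpr fun p => tendsto_pi_nhds.mpr fun q => ?_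
  simpa [div_eq_inv_mul, Matrix.sum_apply, Matrix.vecMulVec_apply] using hω p q

theorem aemeasurable_inv_sampleSecondMoment (hident : ∀ i, IdentDistrib (Z i) (Z 0) μ μ) (n : ℕ) :
    AEMeasurable (fun ω => (fun p q => ((1 / (n : ℝ)) •
      ∑ i ∈ Finset.range n, Matrix.vecMulVec (Z i ω) (Z i ω))⁻¹ p q : ι → ι → ℝ)) μ := by
  refine Matrix.aemeasurable_inv fun p q => ?_
  simp only [Matrix.smul_apply, Matrix.sum_apply, Matrix.vecMulVec_apply, smul_eq_mul]
  have h (i p) : AEMeasurable (fun ω => Z i ω p) μ :=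
    (measurable_pi_apply p).comp_aemeasurable (hident i).aemeasurable_fst
  exact (Finset.aemeasurable_fun_sum _ fun i _ => (h i p).mul (h i q)).const_mul _

omit [Fintype ι] [DecidableEq ι] in
theorem aemeasurable_inv_sqrt_smul_sum (hident : ∀ i, IdentDistrib (Z i) (Z 0) μ μ) (n : ℕ) :
    AEMeasurable (fun ω => WithLp.toLp 2 ((√(n : ℝ))⁻¹ • ∑ i ∈ Finset.range n, Z i ω)) μ := by
  refine (WithLp.measurable_toLp 2 _).comp_aemeasurable ?_
  have h (i) : AEMeasurable (Z i) μ := (hident i).aemeasurable_fst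
  exact AEMeasurable.const_smul (M := ℝ) (Finset.aemeasurable_fun_sum _ fun i _ => h i) _

theorem aemeasurable_studentizedStat (hident : ∀ i, IdentDistrib (Z i) (Z 0) μ μ) (n : ℕ) :
    AEMeasurable (fun ω => studentizedStat (fun i => Z i ω) n) μ := by
  have h := (aemeasurable_inv_sqrt_smul_sum hident n).prodMk
    (aemeasurable_inv_sampleSecondMoment hident n)
  have hg : Measurable fun x : EuclideanSpace ℝ ι × (ι → ι → ℝ) =>
      x.1.ofLp ⬝ᵥ (Matrix.of x.2 *ᵥ x.1.ofLp) := by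
    simp only [dotProduct, Matrix.mulVec, Matrix.of_apply]
    fun_prop
  simp_rw [studentizedStat_eq]
  exact hg.comp_aemeasurable h

variable [IsProbabilityMeasure μ]

/-- Multivariate central limit theorem for centred, square-integrable vectors. -/
theorem tendstoInDistribution_inv_sqrt_smul_sum (hident : ∀ i, IdentDistrib (Z i) (Z 0) μ μ)
    (hindep : iIndepFun Z μ) (hint : ∀ p, MemLp (fun ω => Z 0 ω p) 2 μ)
    (hmean : ∀ p, ∫ ω, Z 0 ω p ∂μ = 0)
    (hS : (Matrix.of fun p q => ∫ ω, Z 0 ω p * Z 0 ω q ∂μ).PosSemidef) :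
    TendstoInDistribution
      (fun (n : ℕ) ω => WithLp.toLp 2 ((√(n : ℝ))⁻¹ • ∑ i ∈ Finset.range n, Z i ω)) atTop
      id (fun _ => μ)
      (multivariateGaussian 0 (Matrix.of fun p q => ∫ ω, Z 0 ω p * Z 0 ω q ∂μ)) where
  forall_aemeasurable := aemeasurable_inv_sqrt_smul_sum hident
  tendsto := by
    -- Cramér–Wold: the characteristic function at `t` is that of the projection on `t`, evaluated
    -- at `1`, so the scalar central limit theorem suffices.
    refine ProbabilityMeasure.tendsto_iff_tendsto_charFun.2 fun t => ?_
    have hm : Measurable fun v : ι → ℝ => v ⬝ᵥ t.ofLp := by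
      simp only [dotProduct]; fun_prop
    have hL2 : MemLp (fun ω => Z 0 ω ⬝ᵥ t.ofLp) 2 μ := by
      simp only [dotProduct]
      exact memLp_finsetSum _ fun p _ => (hint p).mul_const _
    have hmean0 : ∫ ω, Z 0 ω ⬝ᵥ t.ofLp ∂μ = 0 := by
      simp only [dotProduct]
      rw [integral_finsetSum _ fun p _ => ((hint p).integrable one_le_two).mul_const _]
      simp [integral_mul_const, hmean]
    have hvar : Var[fun ω => Z 0 ω ⬝ᵥ t.ofLp; μ] =
        t.ofLp ⬝ᵥ ((Matrix.of fun p q => ∫ ω, Z 0 ω p * Z 0 ω q ∂μ) *ᵥ t.ofLp) := by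
      rw [variance_of_integral_eq_zero hL2.aestronglyMeasurable.aemeasurable hmean0]
      have h1 (ω) : (Z 0 ω ⬝ᵥ t.ofLp) ^ 2 =
          ∑ p, ∑ q, t p * (Z 0 ω p * Z 0 ω q * t q) := by
        rw [sq, dotProduct, Finset.sum_mul_sum]
        exact Finset.sum_congr rfl fun p _ => Finset.sum_congr rfl fun q _ => by ring
      have hi (p q) : Integrable (fun ω => t p * (Z 0 ω p * Z 0 ω q * t q)) μ :=
        (((hint p).integrable_mul (hint q)).mul_const _).const_mul _
      simp_rw [h1]
      rw [integral_finsetSum _ fun p _ => integrable_finsetSum _ fun q _ => hi p q]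
      simp only [dotProduct, Matrix.mulVec, Matrix.of_apply, Finset.mul_sum]
      refine Finset.sum_congr rfl fun p _ => ?_
      rw [integral_finsetSum _ fun q _ => hi p q]
      exact Finset.sum_congr rfl fun q _ => by rw [integral_const_mul, integral_mul_const]
    have hclt := tendstoInDistribution_inv_sqrt_mul_sum_sub
      (X := fun i ω => Z i ω ⬝ᵥ t.ofLp) (P := μ)
      (Y := id) (P' := gaussianReal 0 Var[fun ω => Z 0 ω ⬝ᵥ t.ofLp; μ].toNNReal)
      HasLaw.id hL2
      (hindep.comp (fun _ v => v ⬝ᵥ t.ofLp) fun _ => hm) (fun i => (hident i).comp hm)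
    have hchar := ProbabilityMeasure.tendsto_iff_tendsto_charFun.1 hclt.tendsto 1
    simp only [ProbabilityMeasure.coe_mk, Measure.map_id] at hchar ⊢
    have hvar0 : 0 ≤ Var[fun ω => Z 0 ω ⬝ᵥ t.ofLp; μ] := variance_nonneg _ _
    have hlim : charFun (multivariateGaussian 0
          (Matrix.of fun p q => ∫ ω, Z 0 ω p * Z 0 ω q ∂μ)) t =
        charFun (gaussianReal 0 Var[fun ω => Z 0 ω ⬝ᵥ t.ofLp; μ].toNNReal) 1 := by
      rw [charFun_multivariateGaussian hS, charFun_gaussianReal]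
      simp [hvar, Real.coe_toNNReal _ (hvar ▸ hvar0)]
    rw [hlim]
    refine hchar.congr fun n => ?_
    rw [charFun_apply, charFun_apply,
      integral_map (hclt.forall_aemeasurable n) (by fun_prop),
      integral_map (aemeasurable_inv_sqrt_smul_sum hident n) (by fun_prop)]
    refine integral_congr_ae (ae_of_all _ fun ω => ?_)
    simp only [hmean0, mul_zero, sub_zero]
    congr 3
    simp [EuclideanSpace.inner_eq_star_dotProduct, dotProduct_comm t.ofLp, sum_dotProduct]

/-- The Gaussian law is the image of the standard one under `√S`, and `√S S⁻¹ √S = 1`, so the form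
pulls back to the squared norm of a standard Gaussian vector. -/
theorem map_multivariateGaussian_inv_quadratic_form {S : Matrix ι ι ℝ} (hS : S.PosDef) :
    (multivariateGaussian 0 S).map (fun x => x.ofLp ⬝ᵥ (S⁻¹ *ᵥ x.ofLp)) =
      chiSquared (Fintype.card ι) := by
  have hq : Measurable fun x : EuclideanSpace ℝ ι => x.ofLp ⬝ᵥ (S⁻¹ *ᵥ x.ofLp) := by
    simp only [dotProduct, Matrix.mulVec]; fun_prop
  rw [multivariateGaussian, Measure.map_map hq (by fun_prop), ← map_pi_eq_stdGaussian,
    Measure.map_map (hq.comp (by fun_prop)) (by fun_prop), chiSquared]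
  have hmp := measurePreserving_piCongrLeft (fun _ : ι => gaussianReal 0 1)
    (Fintype.equivFin ι).symm
  rw [← hmp.map_eq, Measure.map_map (hq.comp (by fun_prop) |>.comp (by fun_prop)) hmp.measurable]
  congr 1
  ext z
  simp only [Function.comp_apply, zero_add, Matrix.ofLp_toEuclideanCLM]
  rw [hS.sqrt_dotProduct_inv_mulVec_sqrt, dotProduct]
  rw [← (Fintype.equivFin ι).symm.sum_comp]
  refine Finset.sum_congr rfl fun i _ => ?_
  rw [MeasurableEquiv.piCongrLeft_apply_apply, sq]

/-- Under a vanishing mean the studentized statistic is asymptotically `χ²`. -/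
theorem tendstoInDistribution_studentizedStat (hident : ∀ i, IdentDistrib (Z i) (Z 0) μ μ)
    (hindep : iIndepFun Z μ) (hint : ∀ p, MemLp (fun ω => Z 0 ω p) 2 μ)
    (hmean : ∀ p, ∫ ω, Z 0 ω p ∂μ = 0)
    (hS : (Matrix.of fun p q => ∫ ω, Z 0 ω p * Z 0 ω q ∂μ).PosDef) :
    TendstoInDistribution (fun (n : ℕ) ω => studentizedStat (fun i => Z i ω) n) atTop
      (id : ℝ → ℝ) (fun _ => μ) (chiSquared (Fintype.card ι)) := by
  set S : Matrix ι ι ℝ := Matrix.of fun p q => ∫ ω, Z 0 ω p * Z 0 ω q ∂μ with hSdef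
  have hclt := tendstoInDistribution_inv_sqrt_smul_sum hident hindep hint hmean hS.posSemidef
  have hcov : TendstoInMeasure μ (fun (n : ℕ) ω => (fun p q => ((1 / (n : ℝ)) •
      ∑ i ∈ Finset.range n, Matrix.vecMulVec (Z i ω) (Z i ω))⁻¹ p q : ι → ι → ℝ)) atTop
      (fun _ => (fun p q => S⁻¹ p q : ι → ι → ℝ)) := by
    refine tendstoInMeasure_of_tendsto_ae
      (fun n => (aemeasurable_inv_sampleSecondMoment hident n).aestronglyMeasurable) ?_
    filter_upwards [ae_tendsto_sampleSecondMoment hident hindep hint] with ω hω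
    exact Matrix.tendsto_inv_of_det_ne_zero hω hS.det_pos.ne'
  have hg : Continuous fun x : EuclideanSpace ℝ ι × (ι → ι → ℝ) =>
      x.1.ofLp ⬝ᵥ (Matrix.of x.2 *ᵥ x.1.ofLp) := by
    simp only [dotProduct, Matrix.mulVec, Matrix.of_apply]
    fun_prop
  -- Slutsky: the normalized sum converges in law, the inverse matrix in probability to a constant.
  have h := hclt.continuous_comp_prodMk_of_tendstoInMeasure_const hg hcov
    (aemeasurable_inv_sampleSecondMoment hident)
  refine ⟨aemeasurable_studentizedStat hident, aemeasurable_id, ?_⟩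
  have hlim : (chiSquared (Fintype.card ι)).map id =
      (multivariateGaussian 0 S).map (fun x => x.ofLp ⬝ᵥ (S⁻¹ *ᵥ x.ofLp)) := by
    rw [Measure.map_id, map_multivariateGaussian_inv_quadratic_form hS]
  have ht := h.tendsto
  simp_rw [studentizedStat_eq]
  have hlim' : (⟨(chiSquared (Fintype.card ι)).map id,
      Measure.isProbabilityMeasure_map aemeasurable_id⟩ : ProbabilityMeasure ℝ) =
      ⟨_, Measure.isProbabilityMeasure_map h.aemeasurable_limit⟩ := Subtype.ext hlim
  rw [hlim']
  exact ht

/-- Under a nonvanishing mean the studentized statistic diverges in probability. -/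
theorem tendsto_measure_lt_studentizedStat (hident : ∀ i, IdentDistrib (Z i) (Z 0) μ μ)
    (hindep : iIndepFun Z μ) (hint : ∀ p, MemLp (fun ω => Z 0 ω p) 2 μ)
    (hmean : (fun p => ∫ ω, Z 0 ω p ∂μ) ≠ 0)
    (hS : (Matrix.of fun p q => ∫ ω, Z 0 ω p * Z 0 ω q ∂μ).PosDef) (r : ℝ) :
    Tendsto (fun n : ℕ => μ {ω | r < studentizedStat (fun i => Z i ω) n}) atTop (𝓝 1) := by
  have hpos := hS.inv.dotProduct_mulVec_pos hmean
  have hdiv : ∀ᵐ ω ∂μ, Tendsto (fun n : ℕ => studentizedStat (fun i => Z i ω) n) atTop atTop := by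
    filter_upwards [ae_tendsto_sampleMean hident hindep hint,
      ae_tendsto_sampleSecondMoment hident hindep hint] with ω hω₁ hω₂
    have hinv := Matrix.tendsto_inv_of_det_ne_zero hω₂ hS.det_pos.ne'
    have hg : Continuous fun x : (ι → ℝ) × Matrix ι ι ℝ => x.1 ⬝ᵥ (x.2 *ᵥ x.1) := by
      fun_prop
    have hq := (hg.tendsto _).comp (hω₁.prodMk_nhds hinv)
    exact tendsto_natCast_atTop_atTop.atTop_mul_pos (by simpa using hpos) hq
  -- The statistic is only a.e. measurable; measurable versions make the events measurable, as the
  -- passage from a.e. convergence to measures requires.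
  set f : ℕ → Ω → ℝ := fun n => (aemeasurable_studentizedStat hident n).mk _
  have hf : ∀ᵐ ω ∂μ, ∀ n, studentizedStat (fun i => Z i ω) n = f n ω :=
    ae_all_iff.mpr fun n => (aemeasurable_studentizedStat hident n).ae_eq_mk
  have hset (n : ℕ) : μ {ω | r < studentizedStat (fun i => Z i ω) n} = μ {ω | r < f n ω} := by
    refine measure_congr ?_
    filter_upwards [hf] with ω hω
    exact congrArg (r < ·) (hω n)
  simp_rw [hset]
  rw [← measure_univ (μ := μ)]
  refine tendsto_measure_of_ae_tendsto_indicator_of_isFiniteMeasure atTop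
    MeasurableSet.univ (fun n => measurableSet_lt measurable_const
      (aemeasurable_studentizedStat hident n).measurable_mk) ?_
  filter_upwards [hdiv, hf] with ω hω hωf
  filter_upwards [hω.eventually_gt_atTop r] with n hn
  simpa [← hωf n] using hn

end StudentizedStatistic

/-! ### Trigonometric polynomials and nondegenerate frequencies -/

/-- The frequencies `± tⱼ` are pairwise distinct. -/
def SeparatedFrequencies {E κ : Type*} [AddGroup E] (t : κ → E) : Prop :=
  ∀ j k, t j ≠ - t k ∧ (j ≠ k → t j ≠ t k)

theorem SeparatedFrequencies.sum_elim {E κ κ' : Type*} [AddGroup E] {t : κ → E} {t' : κ' → E}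
    (ht : SeparatedFrequencies t) (ht' : SeparatedFrequencies t')
    (h : ∀ j k, t j ≠ t' k ∧ t j ≠ - t' k) : SeparatedFrequencies (Sum.elim t t') := by
  rintro (j | j) (k | k)
  · simpa using ht j k
  · simpa using (h j k).symm
  · have := h k j
    simp only [Sum.elim_inl, Sum.elim_inr]
    exact ⟨fun h0 => this.2 (by rw [h0, neg_neg]), fun _ h0 => this.1 h0.symm⟩
  · simpa using ht' j k

section TrigonometricPolynomials

open FourierTransform

variable {E : Type*} [NormedAddCommGroup E] [InnerProductSpace ℝ E]

/-- Dedekind's independence of characters, applied to the additive group of `E`. -/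
theorem linearIndependent_cexp_inner {κ : Type*} {s : κ → E} (hs : Function.Injective s) :
    LinearIndependent ℂ (fun (k : κ) (x : E) => Complex.exp ((inner ℝ (s k) x : ℝ) * Complex.I)) := by
  let χ : κ → (Multiplicative E →* ℂ) := fun k =>
    { toFun := fun x => Complex.exp ((inner ℝ (s k) x.toAdd : ℝ) * Complex.I)
      map_one' := by simp
      map_mul' := fun x y => by
        rw [toAdd_mul, inner_add_right, Complex.ofReal_add, add_mul, Complex.exp_add] }
  have hχ : Function.Injective χ := by
    intro j k hjk
    by_contra hne
    have hv : s j - s k ≠ 0 := sub_ne_zero.mpr fun h => hne (hs h)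
    have hpos : 0 < ‖s j - s k‖ ^ 2 := by positivity
    -- At this point the two phases differ by exactly `π`, so the quotient of the exponentials is
    -- `-1`.
    have h := DFunLike.congr_fun hjk
      (Multiplicative.ofAdd ((Real.pi / ‖s j - s k‖ ^ 2) • (s j - s k)))
    simp only [χ, MonoidHom.coe_mk, OneHom.coe_mk, toAdd_ofAdd] at h
    have h1 := Complex.exp_sub
      ((inner ℝ (s j) ((Real.pi / ‖s j - s k‖ ^ 2) • (s j - s k)) : ℝ) * Complex.I)
      ((inner ℝ (s k) ((Real.pi / ‖s j - s k‖ ^ 2) • (s j - s k)) : ℝ) * Complex.I)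
    rw [h, div_self (Complex.exp_ne_zero _), ← sub_mul, ← Complex.ofReal_sub, ← inner_sub_left,
      inner_smul_right, real_inner_self_eq_norm_sq, div_mul_cancel₀ _ hpos.ne',
      Complex.exp_pi_mul_I] at h1
    norm_num at h1
  exact (linearIndependent_monoidHom (Multiplicative E) ℂ).comp χ hχ

theorem analyticOnNhd_cexp_inner (s : E) :
    AnalyticOnNhd ℝ (fun x : E => Complex.exp ((inner ℝ s x : ℝ) * Complex.I)) Set.univ := by
  intro x _
  have h : AnalyticAt ℝ (fun x : E => ((inner ℝ s x : ℝ) : ℂ) * Complex.I) x :=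
    ((Complex.ofRealCLM.comp (innerSL ℝ s)).analyticAt x).mul analyticAt_const
  exact (analyticAt_cexp.restrictScalars (𝕜 := ℝ)).comp h

variable [FiniteDimensional ℝ E] [MeasurableSpace E] [BorelSpace E]

theorem integrable_cexp_inner_mul {P : Measure E} {g : E → ℂ} (hg : Integrable g P) (s : E) :
    Integrable (fun x => Complex.exp ((inner ℝ s x : ℝ) * Complex.I) * g x) P :=
  hg.bdd_mul (c := 1) (by fun_prop) (ae_of_all _ fun x => by rw [Complex.norm_exp_ofReal_mul_I])

/-- A trigonometric polynomial vanishing almost surely under a law with integrable characteristic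
function is trivial. -/
theorem eq_zero_of_ae_sum_cexp_inner_eq_zero {P : Measure E} [IsProbabilityMeasure P]
    (hP : Integrable (charFun P) volume) {κ : Type*} [Fintype κ] {s : κ → E}
    (hs : Function.Injective s) {c : κ → ℂ}
    (h : ∀ᵐ x ∂P, ∑ k, c k * Complex.exp ((inner ℝ (s k) x : ℝ) * Complex.I) = 0) : c = 0 := by
  -- Multiply the vanishing polynomial by `exp(i⟨u, x⟩)` and integrate.
  have hconv (u : E) : ∑ k, c k * charFun P (u + s k) = 0 := by
    have h1 (k) : charFun P (u + s k) = ∫ x, Complex.exp ((inner ℝ u x : ℝ) * Complex.I) *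
        Complex.exp ((inner ℝ (s k) x : ℝ) * Complex.I) ∂P := by
      rw [charFun_apply]
      refine integral_congr_ae (ae_of_all _ fun x => ?_)
      simp only
      rw [← Complex.exp_add, ← add_mul, ← Complex.ofReal_add, ← inner_add_left, real_inner_comm]
    have hi (k) : Integrable (fun x => c k * (Complex.exp ((inner ℝ u x : ℝ) * Complex.I) *
        Complex.exp ((inner ℝ (s k) x : ℝ) * Complex.I))) P := by
      refine (integrable_cexp_inner_mul ?_ u).const_mul _
      simpa using integrable_cexp_inner_mul (integrable_const (μ := P) (1 : ℂ)) (s k)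
    simp_rw [h1, ← integral_const_mul]
    rw [← integral_finsetSum _ fun k _ => hi k]
    refine integral_eq_zero_of_ae ?_
    filter_upwards [h] with x hx
    rw [Pi.zero_apply, ← mul_zero (Complex.exp ((inner ℝ u x : ℝ) * Complex.I)), ← hx,
      Finset.mul_sum]
    exact Finset.sum_congr rfl fun k _ => by ring
  set ψ : E → ℂ := 𝓕 (charFun P) with hψ
  have hshift (k : κ) (v : E) : ∫ u, Complex.exp ((-2 * Real.pi * inner ℝ u v : ℝ) * Complex.I) *
      charFun P (u + s k) =
        Complex.exp ((inner ℝ (s k) ((2 * Real.pi) • v) : ℝ) * Complex.I) * ψ v := by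
    rw [hψ, Real.fourier_eq', ← integral_const_mul]
    refine Eq.trans ?_ (integral_add_right_eq_self (fun u : E =>
      Complex.exp ((inner ℝ (s k) ((2 * Real.pi) • v) : ℝ) * Complex.I) *
        Complex.exp ((-2 * Real.pi * inner ℝ u v : ℝ) * Complex.I) • charFun P u) (s k))
    refine integral_congr_ae (ae_of_all _ fun u => ?_)
    simp only [smul_eq_mul]
    rw [← mul_assoc, ← Complex.exp_add, ← add_mul, ← Complex.ofReal_add]
    congr 4
    rw [inner_add_left, inner_smul_right]
    ring
  -- The Fourier transform turns shifts into phases, so the relation becomes polynomial times `ψ`;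
  -- the `2π` comes from the normalization of `𝓕`.
  have hmul (v : E) :
      (∑ k, c k * Complex.exp ((inner ℝ (s k) ((2 * Real.pi) • v) : ℝ) * Complex.I)) * ψ v = 0 := by
    have hi (k : κ) : Integrable (fun u => c k *
        (Complex.exp ((-2 * Real.pi * inner ℝ u v : ℝ) * Complex.I) * charFun P (u + s k))) := by
      refine (Integrable.bdd_mul (c := 1) (hP.comp_add_right (s k)) (by fun_prop)
        (ae_of_all _ fun x => by rw [Complex.norm_exp_ofReal_mul_I])).const_mul _
    simp_rw [Finset.sum_mul, mul_assoc, ← hshift, ← integral_const_mul]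
    rw [← integral_finsetSum _ fun k _ => hi k]
    refine integral_eq_zero_of_ae (ae_of_all _ fun u => ?_)
    rw [Pi.zero_apply, ← mul_zero (Complex.exp ((-2 * Real.pi * inner ℝ u v : ℝ) * Complex.I)),
      ← hconv u, Finset.mul_sum]
    exact Finset.sum_congr rfl fun k _ => by ring
  have hψc : Continuous ψ := VectorFourier.fourierIntegral_continuous
    Real.continuous_fourierChar continuous_inner hP
  -- If `ψ` were zero, Fourier inversion would give `charFun P 0 = 0`, but this value is `1`.
  obtain ⟨v₀, hv₀⟩ : ∃ v, ψ v ≠ 0 := by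
    by_contra! h0
    have hz : ψ = 0 := funext h0
    have hinv := hP.fourierInv_fourier_eq (v := 0) (by rw [← hψ, hz]; exact integrable_zero _ _ _)
      continuous_charFun.continuousAt
    rw [← hψ, hz, charFun_zero, Real.fourierInv_eq] at hinv
    simp at hinv
  set H : E → ℂ := fun x => ∑ k, c k * Complex.exp ((inner ℝ (s k) x : ℝ) * Complex.I) with hH
  have hHan : AnalyticOnNhd ℝ H Set.univ := by
    intro x hx
    exact Finset.analyticAt_fun_sum _ fun k _ =>
      analyticAt_const.mul (analyticOnNhd_cexp_inner (s k) x hx)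
  -- By continuity `ψ` is nonzero near `v₀`, so `H` vanishes on an open set, hence everywhere by
  -- analyticity.
  have hev : H =ᶠ[𝓝 ((2 * Real.pi) • v₀)] 0 := by
    have hpi : (2 * Real.pi) ≠ 0 := by positivity
    have hcont : ContinuousAt (fun x : E => ψ ((2 * Real.pi)⁻¹ • x)) ((2 * Real.pi) • v₀) := by
      fun_prop
    have hne : ψ ((2 * Real.pi)⁻¹ • ((2 * Real.pi) • v₀)) ≠ 0 := by
      rwa [inv_smul_smul₀ hpi]
    filter_upwards [hcont.eventually_ne hne] with x hx
    have := hmul ((2 * Real.pi)⁻¹ • x)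
    rw [smul_inv_smul₀ hpi] at this
    exact (mul_eq_zero.mp this).resolve_right hx
  have hzero := hHan.eqOn_zero_of_preconnected_of_eventuallyEq_zero isPreconnected_univ
    (Set.mem_univ _) hev
  have hli := Fintype.linearIndependent_iff.mp (linearIndependent_cexp_inner hs) c (by
    ext x
    simpa [hH] using hzero (Set.mem_univ x))
  exact funext hli

/-- The value at `x` of the sine or cosine with frequency `t`. -/
noncomputable def trigWave (t : E) (b : Fin 2) (x : E) : ℝ :=
  if b = 0 then Real.sin (inner ℝ x t) else Real.cos (inner ℝ x t)

/-- Euler's formulas pass to exponentials with frequencies `± t j`, which separation makes distinct;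
the case `j = k` of separation excludes the frequency `0`, whose sine vanishes. -/
theorem SeparatedFrequencies.eq_zero_of_ae_sum_trigWave_eq_zero {P : Measure E}
    [IsProbabilityMeasure P] (hP : Integrable (charFun P) volume) {κ : Type*} [Fintype κ]
    {t : κ → E} (ht : SeparatedFrequencies t) {a : κ × Fin 2 → ℝ}
    (h : ∀ᵐ x ∂P, ∑ p, a p * trigWave (t p.1) p.2 x = 0) : a = 0 := by
  let s : κ × Fin 2 → E := fun p => if p.2 = 0 then t p.1 else - t p.1
  have hs : Function.Injective s := by
    rintro ⟨j, b⟩ ⟨k, b'⟩ hjk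
    have h1 := ht j k
    have h2 := ht k j
    by_cases hjk' : j = k
    · subst hjk'
      fin_cases b <;> fin_cases b' <;> simp [s] at hjk ⊢
      · exact h1.1 hjk
      · exact h1.1 hjk.symm
    · exfalso
      fin_cases b <;> fin_cases b' <;> simp [s] at hjk
      · exact h1.2 hjk' hjk
      · exact h1.1 hjk
      · exact h2.1 hjk.symm
      · exact h1.2 hjk' hjk
  let c : κ × Fin 2 → ℂ := fun p =>
    if p.2 = 0 then (a (p.1, 1) - a (p.1, 0) * Complex.I) / 2
    else (a (p.1, 1) + a (p.1, 0) * Complex.I) / 2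
  have hc : c = 0 := by
    refine eq_zero_of_ae_sum_cexp_inner_eq_zero hP hs ?_
    filter_upwards [h] with x hx
    have hx' := congrArg (fun r : ℝ => (r : ℂ)) hx
    simp only [Complex.ofReal_sum, Complex.ofReal_zero] at hx'
    rw [← hx', Fintype.sum_prod_type, Fintype.sum_prod_type]
    refine Finset.sum_congr rfl fun j _ => ?_
    simp only [Fin.sum_univ_two, c, s, trigWave]
    simp only [Fin.isValue, ↓reduceIte, one_ne_zero, inner_neg_left, Complex.ofReal_neg, neg_mul,
      Complex.ofReal_mul, Complex.ofReal_sin, Complex.ofReal_cos, real_inner_comm x (t j)]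
    rw [← neg_mul, Complex.exp_mul_I, Complex.exp_mul_I, Complex.cos_neg, Complex.sin_neg]
    linear_combination (-(a (j, 0) : ℂ) * Complex.sin (inner ℝ x (t j) : ℝ)) * Complex.I_sq
  ext ⟨j, b⟩
  have h0 : c (j, 0) = 0 := congrFun hc _
  simp only [c, ↓reduceIte, div_eq_zero_iff, OfNat.ofNat_ne_zero, or_false] at h0
  have hre := congrArg Complex.re h0
  have him := congrArg Complex.im h0
  simp at hre him
  fin_cases b
  · exact him
  · exact hre

/-- Multiplied by `f`, no nontrivial trigonometric polynomial with frequencies `t` is `P`-almost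
surely constant. -/
def TrigNondegenerate {κ : Type*} [Fintype κ] (f : E → ℝ) (P : Measure E) (t : κ → E) : Prop :=
  ∀ (a : κ × Fin 2 → ℝ) (c : ℝ), (∀ᵐ x ∂P, ∑ p, a p * (f x * trigWave (t p.1) p.2 x) = c) → a = 0

/-- Failure for both families would represent `1/f` `P`-a.s. by two trigonometric polynomials with
disjoint frequencies. Their difference vanishes a.s., so all coefficients are zero. -/
theorem SeparatedFrequencies.trigNondegenerate_or {P : Measure E} [IsProbabilityMeasure P]
    (hP : Integrable (charFun P) volume) {κ : Type*} [Fintype κ] {f : E → ℝ} (hf : ∀ x, f x ≠ 0)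
    {t t' : κ → E} (ht : SeparatedFrequencies t) (ht' : SeparatedFrequencies t')
    (h : ∀ j k, t j ≠ t' k ∧ t j ≠ - t' k) :
    TrigNondegenerate f P t ∨ TrigNondegenerate f P t' := by
  have key {u : κ → E} (hu : SeparatedFrequencies u) (hn : ¬ TrigNondegenerate f P u) :
      ∃ a : κ × Fin 2 → ℝ, a ≠ 0 ∧ ∀ᵐ x ∂P, ∑ p, a p * trigWave (u p.1) p.2 x = (f x)⁻¹ := by
    simp only [TrigNondegenerate, not_forall] at hn
    obtain ⟨a, c, hac, ha⟩ := hn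
    have hfac (x) : ∑ p, a p * (f x * trigWave (u p.1) p.2 x) =
        f x * ∑ p, a p * trigWave (u p.1) p.2 x := by
      rw [Finset.mul_sum]
      exact Finset.sum_congr rfl fun p _ => by ring
    simp_rw [hfac] at hac
    rcases eq_or_ne c 0 with rfl | hc
    · refine absurd (hu.eq_zero_of_ae_sum_trigWave_eq_zero hP ?_) ha
      filter_upwards [hac] with x hx
      exact (mul_eq_zero.mp hx).resolve_left (hf x)
    · refine ⟨c⁻¹ • a, smul_ne_zero (inv_ne_zero hc) ha, ?_⟩
      filter_upwards [hac] with x hx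
      simp only [Pi.smul_apply, smul_eq_mul, mul_assoc]
      rw [← Finset.mul_sum, ← hx, mul_inv, mul_assoc, inv_mul_cancel₀, mul_one]
      exact fun h0 => hc (by rw [← hx, h0, mul_zero])
  by_contra! hcon
  obtain ⟨a, ha, hax⟩ := key ht hcon.1
  obtain ⟨b, -, hbx⟩ := key ht' hcon.2
  have hzero := (ht.sum_elim ht' h).eq_zero_of_ae_sum_trigWave_eq_zero hP
    (a := fun p => Sum.elim (fun j => a (j, p.2)) (fun j => - b (j, p.2)) p.1) (by
      filter_upwards [hax, hbx] with x hx hx'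
      rw [Fintype.sum_prod_type] at hx hx' ⊢
      simp only [Fintype.sum_sum_type, Sum.elim_inl, Sum.elim_inr, neg_mul, Finset.sum_neg_distrib]
      rw [hx, hx', add_neg_cancel])
  exact ha (funext fun p => congrFun hzero (Sum.inl p.1, p.2))

/-- Independent random frequencies with atomless laws are almost surely nondegenerate. -/
theorem ae_trigNondegenerate {P : Measure E} [IsProbabilityMeasure P]
    (hP : Integrable (charFun P) volume) {κ : Type*} [Fintype κ] {f : E → ℝ} (hf : ∀ x, f x ≠ 0)
    {Ω : Type*} [MeasurableSpace Ω] {μ : Measure Ω} [IsProbabilityMeasure μ]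
    {ν : Measure E} [NullSingletonClass ν] {T : κ → Ω → E} (hT : ∀ j, HasLaw (T j) ν μ)
    (hindep : iIndepFun T μ) : ∀ᵐ ω ∂μ, TrigNondegenerate f P (fun j => T j ω) := by
  have hne (j : κ) (v : E) : ∀ᵐ ω ∂μ, T j ω ≠ v := by
    refine ae_of_ae_map (p := fun x => x ≠ v) (hT j).aemeasurable ?_
    rw [(hT j).map_eq]
    exact Measure.ae_ne ν v
  have hself (j : κ) : ∀ᵐ ω ∂μ, T j ω ≠ - T j ω := by
    filter_upwards [hne j 0] with ω hω h0
    have h2 : (2 : ℝ) • T j ω = 0 := by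
      rw [two_smul]
      nth_rewrite 1 [h0]
      exact neg_add_cancel _
    exact hω ((smul_eq_zero.mp h2).resolve_left two_ne_zero)
  have hpair (j k : κ) (hjk : j ≠ k) : ∀ᵐ ω ∂μ, T j ω ≠ T k ω ∧ T j ω ≠ - T k ω := by
    have : IsProbabilityMeasure ν :=
      (hT j).map_eq ▸ Measure.isProbabilityMeasure_map (hT j).aemeasurable
    have hlaw := (indepFun_iff_map_prod_eq_prod_map_map (hT j).aemeasurable
      (hT k).aemeasurable).mp (hindep.indepFun hjk)
    refine ae_of_ae_map (p := fun x : E × E => x.1 ≠ x.2 ∧ x.1 ≠ - x.2)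
      ((hT j).aemeasurable.prodMk (hT k).aemeasurable) ?_
    rw [hlaw, (hT j).map_eq, (hT k).map_eq]
    have hm : MeasurableSet {x : E × E | x.1 ≠ x.2 ∧ x.1 ≠ - x.2} :=
      (measurableSet_eq_fun measurable_fst measurable_snd).compl.inter
        (measurableSet_eq_fun measurable_fst measurable_snd.neg).compl
    refine (Measure.ae_prod_iff_ae_ae hm).mpr (ae_of_all _ fun x => ?_)
    filter_upwards [Measure.ae_ne ν x, Measure.ae_ne ν (-x)] with y hy hy'
    exact ⟨fun h => hy h.symm, fun h => hy' (by rw [h, neg_neg])⟩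
  have hsep : ∀ᵐ ω ∂μ, SeparatedFrequencies fun j => T j ω := by
    have h1 : ∀ᵐ ω ∂μ, ∀ j k, j ≠ k → T j ω ≠ T k ω ∧ T j ω ≠ - T k ω :=
      ae_all_iff.mpr fun j => ae_all_iff.mpr fun k => by
        by_cases hjk : j = k
        · exact ae_of_all _ fun ω h => absurd hjk h
        · filter_upwards [hpair j k hjk] with ω hω _ using hω
    filter_upwards [h1, ae_all_iff.mpr hself] with ω h1 h2 j k
    refine ⟨?_, fun hjk => (h1 j k hjk).1⟩
    by_cases hjk : j = k
    · exact hjk ▸ h2 j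
    · exact (h1 j k hjk).2
  -- One bad realization `ω₀` certifies every separated realization avoiding the finitely many
  -- points `± T k ω₀`. This also avoids any measurability question about the bad set.
  by_cases hbad : ∃ ω₀, SeparatedFrequencies (fun j => T j ω₀) ∧
      ¬ TrigNondegenerate f P (fun j => T j ω₀)
  · obtain ⟨ω₀, h₀, hn₀⟩ := hbad
    filter_upwards [hsep, ae_all_iff.mpr fun j => ae_all_iff.mpr fun k => hne j (T k ω₀),
      ae_all_iff.mpr fun j => ae_all_iff.mpr fun k => hne j (- T k ω₀)] with ω hω h1 h2
    exact (hω.trigNondegenerate_or hP hf h₀ fun j k => ⟨h1 j k, h2 j k⟩).resolve_right hn₀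
  · push Not at hbad
    filter_upwards [hsep] with ω hω using hbad ω hω

end TrigonometricPolynomials

/-! ### Regrouping independent families -/

section Independence

variable {Ω E : Type*} [MeasurableSpace Ω] [MeasurableSpace E] {μ : Measure Ω}
  [IsProbabilityMeasure μ]

/-- Independence says that the joint law is a product, and a product over `ι × κ` curries to a
product of products. -/
theorem ProbabilityTheory.iIndepFun.curry {ι κ : Type*} [Countable ι] [Countable κ]
    {X : ι → κ → Ω → E} (hm : ∀ i j, AEMeasurable (X i j) μ)
    (h : iIndepFun (fun (p : ι × κ) => X p.1 p.2) μ) :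
    iIndepFun (fun i ω j => X i j ω) μ := by
  have _ (i j) : IsProbabilityMeasure (μ.map (X i j)) := Measure.isProbabilityMeasure_map (hm i j)
  have hm' (i) : AEMeasurable (fun ω j => X i j ω) μ := aemeasurable_pi_lambda _ (hm i)
  rw [iIndepFun_iff_map_fun_eq_infinitePi_map₀' hm']
  have hrow (i) : μ.map (fun ω j => X i j ω) = Measure.infinitePi fun j => μ.map (X i j) :=
    (h.precomp (g := fun j => (i, j)) (Prod.mk_right_injective i)).map_fun_eq_infinitePi_map₀'
      (hm i)
  have hall := h.map_fun_eq_infinitePi_map₀' fun p : ι × κ => hm p.1 p.2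
  simp_rw [hrow]
  rw [← Measure.infinitePi_map_curry, ← hall, AEMeasurable.map_map_of_aemeasurable
    (by fun_prop) (aemeasurable_pi_lambda _ fun p : ι × κ => hm p.1 p.2)]
  rfl

theorem ProbabilityTheory.iIndepFun.prodMk_of_sum_elim {ι : Type*} [Countable ι] {X Y : ι → Ω → E}
    (hX : ∀ i, AEMeasurable (X i) μ) (hY : ∀ i, AEMeasurable (Y i) μ)
    (h : iIndepFun (Sum.elim X Y) μ) : iIndepFun (fun i ω => (X i ω, Y i ω)) μ := by
  let g : ι × Fin 2 → ι ⊕ ι := fun p => if p.2 = 0 then Sum.inl p.1 else Sum.inr p.1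
  have hg : Function.Injective g := by
    rintro ⟨i, b⟩ ⟨j, b'⟩ hij
    fin_cases b <;> fin_cases b' <;> simp_all [g]
  have h1 : iIndepFun (fun i ω (j : Fin 2) => Sum.elim X Y (g (i, j)) ω) μ := by
    refine iIndepFun.curry (X := fun i j => Sum.elim X Y (g (i, j))) (fun i j => ?_)
      (h.precomp hg)
    fin_cases j
    · simpa [g] using hX i
    · simpa [g] using hY i
  have h2 := h1.comp (fun _ (v : Fin 2 → E) => (v 0, v 1)) fun _ => by fun_prop
  simpa [Function.comp_def, g] using h2

end Independence

/-! ### Smooth characteristic functions and the moments of the difference vector -/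

section SmoothCharFun

variable {d : ℕ} {l : EuclideanSpace ℝ (Fin d) → ℝ}

theorem norm_cexp_neg_I_mul_inner (w x : EuclideanSpace ℝ (Fin d)) :
    ‖Complex.exp (-Complex.I * (inner ℝ w x : ℂ))‖ = 1 := by
  rw [show -Complex.I * ((inner ℝ w x : ℝ) : ℂ) = ((-inner ℝ w x : ℝ) : ℂ) * Complex.I by
    push_cast; ring, Complex.norm_exp_ofReal_mul_I]

theorem norm_invFourierKernel_le (l : EuclideanSpace ℝ (Fin d) → ℝ)
    (x : EuclideanSpace ℝ (Fin d)) : ‖invFourierKernel l x‖ ≤ ∫ w, ‖l w‖ := by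
  refine (norm_integral_le_integral_norm _).trans_eq (integral_congr_ae (ae_of_all _ fun w => ?_))
  simp only [norm_mul, norm_cexp_neg_I_mul_inner, one_mul, Complex.norm_real]

theorem continuous_invFourierKernel (hl : Integrable l volume) :
    Continuous (invFourierKernel l) := by
  refine continuous_of_dominated (bound := fun w => ‖l w‖) (fun x => ?_) (fun x => ?_) hl.norm
    (ae_of_all _ fun w => by fun_prop)
  · exact (Continuous.aestronglyMeasurable (by fun_prop)).mul hl.ofReal.aestronglyMeasurable
  · refine ae_of_all _ fun w => le_of_eq ?_
    simp only [norm_mul, norm_cexp_neg_I_mul_inner, one_mul, Complex.norm_real]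

theorem integrable_cexp_mul_invFourierKernel (hl : Integrable l volume)
    (P : Measure (EuclideanSpace ℝ (Fin d))) [IsProbabilityMeasure P]
    (t : EuclideanSpace ℝ (Fin d)) :
    Integrable (fun x => Complex.exp ((inner ℝ x t : ℝ) * Complex.I) * invFourierKernel l x) P := by
  have hc := continuous_invFourierKernel hl
  refine Integrable.of_bound (C := ∫ w, ‖l w‖) (Continuous.aestronglyMeasurable (by fun_prop))
    (ae_of_all _ fun x => ?_)
  rw [norm_mul, Complex.norm_exp_ofReal_mul_I, one_mul]
  exact norm_invFourierKernel_le l x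

/-- The smooth characteristic function is the characteristic function of `f • P`. -/
theorem smoothCharFun_eq_integral (hl : Integrable l volume)
    (P : Measure (EuclideanSpace ℝ (Fin d))) [IsProbabilityMeasure P]
    (t : EuclideanSpace ℝ (Fin d)) :
    smoothCharFun l P t =
      ∫ x, Complex.exp ((inner ℝ x t : ℝ) * Complex.I) * invFourierKernel l x ∂P := by
  have hlt : Integrable (fun w => (l (t - w) : ℂ)) volume := (hl.comp_sub_left t).ofReal
  have hprod : Integrable (fun p : EuclideanSpace ℝ (Fin d) × EuclideanSpace ℝ (Fin d) =>
      Complex.exp ((inner ℝ p.2 p.1 : ℝ) * Complex.I) * (l (t - p.1) : ℂ)) (volume.prod P) := by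
    refine Integrable.bdd_mul (c := 1) (hlt.comp_fst P) (by fun_prop) (ae_of_all _ fun p => ?_)
    rw [Complex.norm_exp_ofReal_mul_I]
  calc smoothCharFun l P t
      = ∫ w, (∫ x, Complex.exp ((inner ℝ x w : ℝ) * Complex.I) * (l (t - w) : ℂ) ∂P) := by
        simp only [smoothCharFun, charFun_apply, integral_mul_const]
    _ = ∫ x, (∫ w, Complex.exp ((inner ℝ x w : ℝ) * Complex.I) * (l (t - w) : ℂ)) ∂P :=
        integral_integral_swap (f := fun w x : EuclideanSpace ℝ (Fin d) =>
          Complex.exp ((inner ℝ x w : ℝ) * Complex.I) * (l (t - w) : ℂ)) hprod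
    _ = _ := by
        refine integral_congr_ae (ae_of_all _ fun x => ?_)
        simp only [invFourierKernel]
        rw [← integral_const_mul, ← integral_sub_left_eq_self _ volume t]
        -- After `w ↦ t - w`, the phase `⟨x, t - w⟩` splits into the outer factor and the kernel of
        -- `f`.
        refine integral_congr_ae (ae_of_all _ fun w => ?_)
        simp only [sub_sub_cancel]
        rw [← mul_assoc, ← Complex.exp_add]
        congr 2
        rw [inner_sub_right, real_inner_comm x w]
        push_cast
        ring

variable {J : ℕ}

theorem smoothCFFeature_apply (l : EuclideanSpace ℝ (Fin d) → ℝ)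
    (t : Fin J → EuclideanSpace ℝ (Fin d)) (x : EuclideanSpace ℝ (Fin d)) (p : Fin J × Fin 2) :
    smoothCFFeature l t x p = (invFourierKernel l x).re * trigWave (t p.1) p.2 x := rfl

theorem cexp_mul_invFourierKernel_eq (him : ∀ x, (invFourierKernel l x).im = 0)
    (t : Fin J → EuclideanSpace ℝ (Fin d)) (x : EuclideanSpace ℝ (Fin d)) (j : Fin J) :
    Complex.exp ((inner ℝ x (t j) : ℝ) * Complex.I) * invFourierKernel l x =
      ⟨smoothCFFeature l t x (j, 1), smoothCFFeature l t x (j, 0)⟩ := by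
  apply Complex.ext
  · rw [Complex.mul_re, Complex.exp_ofReal_mul_I_re, Complex.exp_ofReal_mul_I_im, him]
    simp [smoothCFFeature, mul_comm]
  · rw [Complex.mul_im, Complex.exp_ofReal_mul_I_re, Complex.exp_ofReal_mul_I_im, him]
    simp [smoothCFFeature, mul_comm]

theorem continuous_smoothCFFeature (hl : Integrable l volume)
    (t : Fin J → EuclideanSpace ℝ (Fin d)) : Continuous (smoothCFFeature l t) := by
  have hc := continuous_invFourierKernel hl
  refine continuous_pi fun p => ?_
  simp only [smoothCFFeature]
  split_ifs <;> fun_prop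

theorem abs_smoothCFFeature_le (l : EuclideanSpace ℝ (Fin d) → ℝ)
    (t : Fin J → EuclideanSpace ℝ (Fin d)) (x : EuclideanSpace ℝ (Fin d)) (p : Fin J × Fin 2) :
    |smoothCFFeature l t x p| ≤ ∫ w, ‖l w‖ := by
  have h1 : |(invFourierKernel l x).re| ≤ ∫ w, ‖l w‖ :=
    (Complex.abs_re_le_norm _).trans (norm_invFourierKernel_le l x)
  have h2 : |trigWave (t p.1) p.2 x| ≤ 1 := by
    unfold trigWave
    split_ifs
    · exact Real.abs_sin_le_one _
    · exact Real.abs_cos_le_one _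
  rw [smoothCFFeature_apply, abs_mul]
  exact (mul_le_of_le_one_right (abs_nonneg _) h2).trans h1

theorem integrable_smoothCFFeature (hl : Integrable l volume)
    (P : Measure (EuclideanSpace ℝ (Fin d))) [IsProbabilityMeasure P]
    (t : Fin J → EuclideanSpace ℝ (Fin d)) (p : Fin J × Fin 2) :
    Integrable (fun x => smoothCFFeature l t x p) P :=
  Integrable.of_bound (C := ∫ w, ‖l w‖)
    ((continuous_apply p).comp (continuous_smoothCFFeature hl t)).aestronglyMeasurable
    (ae_of_all _ fun x => abs_smoothCFFeature_le l t x p)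

theorem smoothCharFun_eq_mk (hl : Integrable l volume) (him : ∀ x, (invFourierKernel l x).im = 0)
    (P : Measure (EuclideanSpace ℝ (Fin d))) [IsProbabilityMeasure P]
    (t : Fin J → EuclideanSpace ℝ (Fin d)) (j : Fin J) :
    smoothCharFun l P (t j) =
      ⟨∫ x, smoothCFFeature l t x (j, 1) ∂P, ∫ x, smoothCFFeature l t x (j, 0) ∂P⟩ := by
  have hi := integrable_cexp_mul_invFourierKernel hl P (t j)
  rw [smoothCharFun_eq_integral hl]
  apply Complex.ext
  · rw [← RCLike.re_eq_complex_re, ← integral_re hi]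
    simp only [cexp_mul_invFourierKernel_eq him, RCLike.re_eq_complex_re]
  · rw [← RCLike.im_eq_complex_im, ← integral_im hi]
    simp only [cexp_mul_invFourierKernel_eq him, RCLike.im_eq_complex_im]

theorem smoothCFDistSq_eq_zero_iff (hJ : 0 < J) (hl : Integrable l volume)
    (him : ∀ x, (invFourierKernel l x).im = 0)
    (P Q : Measure (EuclideanSpace ℝ (Fin d))) [IsProbabilityMeasure P] [IsProbabilityMeasure Q]
    (t : Fin J → EuclideanSpace ℝ (Fin d)) :
    smoothCFDistSq l P Q t = 0 ↔
      ∀ p, ∫ x, smoothCFFeature l t x p ∂P - ∫ x, smoothCFFeature l t x p ∂Q = 0 := by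
  have hJ' : (1 / (J : ℝ)) ≠ 0 := by positivity
  rw [smoothCFDistSq, mul_eq_zero, or_iff_right hJ',
    Finset.sum_eq_zero_iff_of_nonneg fun j _ => by positivity]
  simp only [Finset.mem_univ, true_implies, sq_eq_zero_iff, norm_eq_zero, sub_eq_zero,
    smoothCharFun_eq_mk hl him, Complex.mk.injEq, Prod.forall, Fin.forall_fin_two]
  exact forall_congr' fun j => and_comm

theorem integral_smoothCFDiff (hl : Integrable l volume)
    (P Q : Measure (EuclideanSpace ℝ (Fin d))) [IsProbabilityMeasure P] [IsProbabilityMeasure Q]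
    (t : Fin J → EuclideanSpace ℝ (Fin d)) (p : Fin J × Fin 2) :
    ∫ z, smoothCFDiff l t z.1 z.2 p ∂(P.prod Q) =
      ∫ x, smoothCFFeature l t x p ∂P - ∫ x, smoothCFFeature l t x p ∂Q := by
  simp only [smoothCFDiff, Pi.sub_apply]
  rw [integral_sub ((integrable_smoothCFFeature hl P t p).comp_fst Q)
    ((integrable_smoothCFFeature hl Q t p).comp_snd P),
    integral_fun_fst (fun x => smoothCFFeature l t x p),
    integral_fun_snd (fun x => smoothCFFeature l t x p)]
  simp

theorem continuous_smoothCFDiff (hl : Integrable l volume)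
    (t : Fin J → EuclideanSpace ℝ (Fin d)) :
    Continuous fun z : EuclideanSpace ℝ (Fin d) × EuclideanSpace ℝ (Fin d) =>
      smoothCFDiff l t z.1 z.2 :=
  ((continuous_smoothCFFeature hl t).comp continuous_fst).sub
    ((continuous_smoothCFFeature hl t).comp continuous_snd)

theorem memLp_smoothCFDiff (hl : Integrable l volume)
    (P Q : Measure (EuclideanSpace ℝ (Fin d))) [IsProbabilityMeasure P] [IsProbabilityMeasure Q]
    (t : Fin J → EuclideanSpace ℝ (Fin d)) (p : Fin J × Fin 2) :
    MemLp (fun z : EuclideanSpace ℝ (Fin d) × EuclideanSpace ℝ (Fin d) =>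
      smoothCFDiff l t z.1 z.2 p) 2 (P.prod Q) := by
  refine MemLp.of_bound
    ((continuous_apply p).comp (continuous_smoothCFDiff hl t)).aestronglyMeasurable
    ((∫ w, ‖l w‖) + ∫ w, ‖l w‖) (ae_of_all _ fun z => ?_)
  exact (abs_sub _ _).trans
    (add_le_add (abs_smoothCFFeature_le l t z.1 p) (abs_smoothCFFeature_le l t z.2 p))

/-- The quadratic form at `a` is the integral of `(aᵀ Z)²`. If it vanishes, then for some fixed `y`
the combination `aᵀ smoothCFFeature l t x` is constant for `P`-almost every `x`, so `a = 0`. -/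
theorem posDef_secondMoment_smoothCFDiff (hl : Integrable l volume)
    {P Q : Measure (EuclideanSpace ℝ (Fin d))} [IsProbabilityMeasure P] [IsProbabilityMeasure Q]
    {t : Fin J → EuclideanSpace ℝ (Fin d)}
    (ht : TrigNondegenerate (fun x => (invFourierKernel l x).re) P t) :
    (Matrix.of fun p q => ∫ z, smoothCFDiff l t z.1 z.2 p * smoothCFDiff l t z.1 z.2 q
      ∂(P.prod Q)).PosDef := by
  refine Matrix.PosDef.of_dotProduct_mulVec_pos ?_ fun a ha => ?_
  · ext p q
    simp only [Matrix.conjTranspose_apply, Matrix.of_apply, star_trivial, mul_comm]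
  have hL2 := memLp_smoothCFDiff hl P Q t
  have hi (p q) : Integrable (fun z : EuclideanSpace ℝ (Fin d) × EuclideanSpace ℝ (Fin d) =>
      a p * (smoothCFDiff l t z.1 z.2 p * smoothCFDiff l t z.1 z.2 q * a q)) (P.prod Q) :=
    (((hL2 p).integrable_mul (hL2 q)).mul_const _).const_mul _
  have hsq (z : EuclideanSpace ℝ (Fin d) × EuclideanSpace ℝ (Fin d)) :
      (a ⬝ᵥ smoothCFDiff l t z.1 z.2) ^ 2 = ∑ p, ∑ q,
        a p * (smoothCFDiff l t z.1 z.2 p * smoothCFDiff l t z.1 z.2 q * a q) := by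
    rw [sq, dotProduct, Finset.sum_mul_sum]
    exact Finset.sum_congr rfl fun p _ => Finset.sum_congr rfl fun q _ => by ring
  have hquad : star a ⬝ᵥ ((Matrix.of fun p q => ∫ z, smoothCFDiff l t z.1 z.2 p *
      smoothCFDiff l t z.1 z.2 q ∂(P.prod Q)) *ᵥ a) =
      ∫ z, (a ⬝ᵥ smoothCFDiff l t z.1 z.2) ^ 2 ∂(P.prod Q) := by
    simp_rw [hsq]
    rw [integral_finsetSum _ fun p _ => integrable_finsetSum _ fun q _ => hi p q]
    simp only [star_trivial, dotProduct, Matrix.mulVec, Matrix.of_apply, Finset.mul_sum]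
    refine Finset.sum_congr rfl fun p _ => ?_
    rw [integral_finsetSum _ fun q _ => hi p q]
    exact Finset.sum_congr rfl fun q _ => by rw [integral_const_mul, integral_mul_const]
  rw [hquad]
  have hint : Integrable (fun z : EuclideanSpace ℝ (Fin d) × EuclideanSpace ℝ (Fin d) =>
      (a ⬝ᵥ smoothCFDiff l t z.1 z.2) ^ 2) (P.prod Q) := by
    simp_rw [hsq]
    exact integrable_finsetSum _ fun p _ => integrable_finsetSum _ fun q _ => hi p q
  refine (integral_nonneg fun z => sq_nonneg _).lt_of_ne fun h0 => ha ?_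
  have hae := (integral_eq_zero_iff_of_nonneg (fun z => sq_nonneg _) hint).mp h0.symm
  -- Swapping the factors lets Fubini freeze `y` and leave an a.e. statement in `x`.
  have hswap : ∀ᵐ z ∂(Q.prod P), a ⬝ᵥ smoothCFDiff l t z.2 z.1 = 0 := by
    rw [← Measure.prod_swap] at hae
    filter_upwards [ae_of_ae_map measurable_swap.aemeasurable hae] with z hz
    exact pow_eq_zero_iff two_ne_zero |>.mp hz
  obtain ⟨y, hy⟩ := (Measure.ae_ae_of_ae_prod hswap).exists
  refine ht a (a ⬝ᵥ smoothCFFeature l t y) ?_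
  filter_upwards [hy] with x hx
  rw [smoothCFDiff, dotProduct_sub, sub_eq_zero] at hx
  exact hx

end SmoothCharFun

/-! ### The main theorem -/

theorem proposition4
    {d J : ℕ} (hd : 0 < d) (hJ : 0 < J)
    -- the smoothing kernel: analytic, integrable, with strictly positive inverse Fourier transform
    (l : EuclideanSpace ℝ (Fin d) → ℝ)
    (hl_analytic : AnalyticOnNhd ℝ l Set.univ)
    (hl_int : Integrable l volume)
    (hl_pos : ∀ x, (invFourierKernel l x).im = 0 ∧ 0 < (invFourierKernel l x).re)
    -- the two distributions, with integrable characteristic functions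
    (P Q : Measure (EuclideanSpace ℝ (Fin d))) [IsProbabilityMeasure P] [IsProbabilityMeasure Q]
    (hP : Integrable (charFun P) volume) (hQ : Integrable (charFun Q) volume)
    -- the i.i.d. test points, with an absolutely continuous law
    {Ω₁ : Type*} [MeasurableSpace Ω₁] (ℙ₁ : Measure Ω₁) [IsProbabilityMeasure ℙ₁]
    (ν : Measure (EuclideanSpace ℝ (Fin d))) (hν : ν ≪ volume)
    (T : Fin J → Ω₁ → EuclideanSpace ℝ (Fin d))
    (hT_law : ∀ j, HasLaw (T j) ν ℙ₁) (hT_indep : iIndepFun T ℙ₁)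
    -- the two independent i.i.d. samples
    {Ω₂ : Type*} [MeasurableSpace Ω₂] (ℙ₂ : Measure Ω₂) [IsProbabilityMeasure ℙ₂]
    (X Y : ℕ → Ω₂ → EuclideanSpace ℝ (Fin d))
    (hX_law : ∀ i, HasLaw (X i) P ℙ₂) (hY_law : ∀ i, HasLaw (Y i) Q ℙ₂)
    (hXY_indep : iIndepFun (Sum.elim X Y) ℙ₂) :
    ∀ᵐ ω₁ ∂ℙ₁,
      (smoothCFDistSq l P Q (fun j => T j ω₁) = 0 →
        TendstoInDistribution
          (fun (n : ℕ) (ω₂ : Ω₂) =>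
            smoothCFStat l (fun j => T j ω₁) (fun i => X i ω₂) (fun i => Y i ω₂) n)
          atTop (id : ℝ → ℝ) (fun _ => ℙ₂) (chiSquared (2 * J))) ∧
      (0 < smoothCFDistSq l P Q (fun j => T j ω₁) →
        ∀ r : ℝ, Tendsto
          (fun n : ℕ => ℙ₂ {ω₂ |
            r < smoothCFStat l (fun j => T j ω₁) (fun i => X i ω₂) (fun i => Y i ω₂) n})
          atTop (𝓝 1)) := by
  -- Positive dimension makes Lebesgue measure atomless, and `ν` inherits this by absolute
  -- continuity.
  have : Nontrivial (EuclideanSpace ℝ (Fin d)) := by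
    have : Nonempty (Fin d) := ⟨⟨0, hd⟩⟩
    infer_instance
  have : NullSingletonClass ν := ⟨fun x => hν (measure_singleton x)⟩
  have hpair (i : ℕ) : HasLaw (fun ω => (X i ω, Y i ω)) (P.prod Q) ℙ₂ := by
    refine ⟨(hX_law i).aemeasurable.prodMk (hY_law i).aemeasurable, ?_⟩
    have hij : IndepFun (X i) (Y i) ℙ₂ :=
      hXY_indep.indepFun (i := Sum.inl i) (j := Sum.inr i) Sum.inl_ne_inr
    rw [(indepFun_iff_map_prod_eq_prod_map_map (hX_law i).aemeasurable
      (hY_law i).aemeasurable).mp hij, (hX_law i).map_eq, (hY_law i).map_eq]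
  have hindep := hXY_indep.prodMk_of_sum_elim (fun i => (hX_law i).aemeasurable)
    fun i => (hY_law i).aemeasurable
  filter_upwards [ae_trigNondegenerate hP (f := fun x => (invFourierKernel l x).re)
    (fun x => (hl_pos x).2.ne') hT_law hT_indep] with ω₁ hω₁
  set t : Fin J → EuclideanSpace ℝ (Fin d) := fun j => T j ω₁
  have hD := continuous_smoothCFDiff hl_int t
  have hint (g : EuclideanSpace ℝ (Fin d) × EuclideanSpace ℝ (Fin d) → ℝ) (hg : Continuous g) :
      ∫ ω, g (X 0 ω, Y 0 ω) ∂ℙ₂ = ∫ z, g z ∂(P.prod Q) :=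
    (hpair 0).integral_comp hg.aestronglyMeasurable
  let Z : ℕ → Ω₂ → Fin J × Fin 2 → ℝ := fun i ω => smoothCFDiff l t (X i ω) (Y i ω)
  have hZident (i) : IdentDistrib (Z i) (Z 0) ℙ₂ ℙ₂ :=
    ((hpair i).identDistrib (hpair 0)).comp hD.measurable
  have hZindep : iIndepFun Z ℙ₂ :=
    hindep.comp (fun _ z => smoothCFDiff l t z.1 z.2) fun _ => hD.measurable
  have hZint (p) : MemLp (fun ω => Z 0 ω p) 2 ℙ₂ := by
    have h := memLp_smoothCFDiff hl_int P Q t p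
    rw [← (hpair 0).map_eq] at h
    exact h.comp_of_map (hpair 0).aemeasurable
  have hZmean (p) : ∫ ω, Z 0 ω p ∂ℙ₂ =
      ∫ x, smoothCFFeature l t x p ∂P - ∫ x, smoothCFFeature l t x p ∂Q := by
    rw [← integral_smoothCFDiff hl_int P Q t p]
    exact hint _ ((continuous_apply p).comp hD)
  have hZcov : (Matrix.of fun p q => ∫ ω, Z 0 ω p * Z 0 ω q ∂ℙ₂).PosDef := by
    convert posDef_secondMoment_smoothCFDiff hl_int (Q := Q) hω₁ using 4 with p q
    exact hint _ (((continuous_apply p).comp hD).mul ((continuous_apply q).comp hD))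
  have hzero := smoothCFDistSq_eq_zero_iff hJ hl_int (fun x => (hl_pos x).1) P Q t
  simp_rw [← hZmean] at hzero
  constructor
  · intro h0
    have hcard : Fintype.card (Fin J × Fin 2) = 2 * J := by simp [mul_comm]
    rw [← hcard]
    exact tendstoInDistribution_studentizedStat hZident hZindep hZint (hzero.mp h0) hZcov
  · intro hpos r
    exact tendsto_measure_lt_studentizedStat hZident hZindep hZint
      (fun h => hpos.ne' (hzero.mpr (congrFun h))) hZcov r
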